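/- **Setup.** Let $d\ge 0$ be an integer and $[d]=\{1,\dots,d\}$. A *balanced relative simplicial complex* $\Phi$ of dimension $d-1$ on a vertex set $V$ is a non-empty finite collection $\Phi$ of finite subsets of $V$ (faces) together with a coloring $\kappa:V\to[d]$ such that: (1) if $\rho\subseteq\sigma\subseteq\tau$ and $\rho,\tau\in\Phi$, then $\sigma\in\Phi$; (2) every $\rho\in\Phi$ is contained in some $\sigma\in\Phi$ with $|\sigma|=d$; (3) $|\kappa(\rho)|=|\rho|$ for every $\rho\in\Phi$. Let $\Delta$ be the simplicial complex of all subsets of faces of $\Phi$ and let $\Gamma=\Delta\setminus\Phi$, which is a subcomplex of $\Delta$. For $\sigma\in\Delta$ put $\mathrm{lk}_\Delta(\sigma)=\{\tau\in\Delta:\tau\cap\sigma=\emptyset,\ \tau\cup\sigma\in\Delta\}$, define $\mathrm{lk}_\Gamma(\sigma)$ in the same way, and put $\mathrm{lk}_\Phi(\sigma)=\mathrm{lk}_\Delta(\sigma)\setminus\mathrm{lk}_\Gamma(\sigma)$, whose dimension is the maximum of $|\tau|-1$ over its faces $\tau$. For an integer $\ell\ge 0$, $\Phi$ satisfies *Serre's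 condition* $(S_\ell)$ if, for all $\sigma\in\Delta$ and all integers $i\le\min(\dim \mathrm{lk}_\Phi(\sigma),\ell-1)$, the reduced relative simplicial homology with complex coefficients satisfies $$\widetilde H_{i-1}\bigl(\mathrm{lk}_\Delta(\sigma),\mathrm{lk}_\Gamma(\sigma)\bigr)=0 .$$ A finite group $\mathfrak G$ acting on $V$ *acts on* $\Phi$ if $\mathfrak g\sigma\in\Phi$ and $\kappa(\mathfrak g v)=\kappa(v)$ for all $\mathfrak g\in\mathfrak G$, $\sigma\in\Phi$, $v\in V$. In that case define, for $S\subseteq[d]$, $\mathfrak g\in\mathfrak G$ and an integer $i\ge 0$, $$f_S(\Phi,\mathfrak G;\mathfrak g)=\bigl|\{\sigma\in\Phi:\kappa(\sigma)=S,\ \mathfrak g\sigma=\sigma\}\bigr|,\qquad h_S(\Phi,\mathfrak G)=\sum_{T\subseteq S}(-1)^{|S\setminus T|}f_T(\Phi,\mathfrak G),\qquad h_i(\Phi,\mathfrak G)=\sum_{S\subseteq[d],\,|S|=i}h_S(\Phi,\mathfrak G).$$ A function $\mathfrak G\to\mathbb C$ is an *effective character* if it is the character of a (possibly zero) finite-dimensional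 complex representation of $\mathfrak G$. **Theorem.** Let $\Phi$ be a balanced relative simplicial complex of dimension $d-1$, let the finite group $\mathfrak G$ act on $\Phi$, and suppose that $\Phi$ satisfies $(S_\ell)$, where $\ell\ge 0$. Then $h_i(\Phi,\mathfrak G)$ is an effective character for every $0\le i\le\ell$. Moreover, for all integers $0\le i\le\ell\le j\le d$, the function $$\sum_{k=\ell}^{j}\binom{d-k}{j-k}\binom{k-\ell+i}{i}\,h_k(\Phi,\mathfrak G)$$ is an effective character. -/

import Mathlib

open scoped Pointwise

noncomputable section

/-- A balanced relative simplicial complex of dimension `d - 1` on the vertex set `V`, with the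
colors `[d]` indexed by `Fin d`. -/
structure BalancedRelComplex (V : Type*) [DecidableEq V] (d : ℕ) where
  /-- The collection of faces. -/
  faces : Finset (Finset V)
  /-- The coloring of the vertices. -/
  color : V → Fin d
  nonempty : faces.Nonempty
  convex : ∀ ρ σ τ : Finset V, ρ ⊆ σ → σ ⊆ τ → ρ ∈ faces → τ ∈ faces → σ ∈ faces
  pure : ∀ ρ ∈ faces, ∃ σ ∈ faces, ρ ⊆ σ ∧ σ.card = d
  rainbow : ∀ ρ ∈ faces, (ρ.image color).card = ρ.card

namespace BalancedRelComplex

section Homology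

variable {V : Type*} [DecidableEq V] {d : ℕ}

/-- The link of `σ` in the simplicial complex `Δ`. -/
def link (Δ : Finset (Finset V)) (σ : Finset V) : Finset (Finset V) :=
  Δ.filter (fun τ => Disjoint τ σ ∧ τ ∪ σ ∈ Δ)

/-- The dimension of a non-empty collection of faces: the largest size of a face, minus one. -/
def dim (X : Finset (Finset V)) : ℤ := ((X.sup Finset.card : ℕ) : ℤ) - 1

/-- The `K`-vector space spanned by the members of `X` that have `n` elements
(that is, dimension `n - 1`). -/
def chains (K : Type*) [Field K] (X : Finset (Finset V)) (n : ℕ) : Submodule K (Finset V →₀ K) :=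
  Finsupp.supported K K {σ : Finset V | σ ∈ X ∧ σ.card = n}

/-- The augmented simplicial boundary map, where every face is oriented by listing its vertices in
increasing order of their colors: `∂ [v₀, …, vₘ] = ∑ₖ (-1) ^ k [v₀, …, v̂ₖ, …, vₘ]`. It is only
applied to faces whose vertices have distinct colors. -/
def boundary (K : Type*) [Field K] (κ : V → Fin d) : (Finset V →₀ K) →ₗ[K] (Finset V →₀ K) :=
  Finsupp.linearCombination K (fun σ : Finset V =>
    ∑ v ∈ σ, Finsupp.single (σ.erase v)
      ((-1 : K) ^ (σ.filter (fun w => κ w < κ v)).card))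

/-- Relative cycles of the pair `(Δ, Γ)` in dimension `n - 1`: chains of `Δ` whose boundary is a
chain of `Γ`. -/
def relCycles (K : Type*) [Field K] (κ : V → Fin d) (Δ Γ : Finset (Finset V)) (n : ℕ) :
    Submodule K (Finset V →₀ K) :=
  chains K Δ n ⊓ (Finsupp.supported K K {σ : Finset V | σ ∈ Γ}).comap (boundary K κ)

/-- Relative boundaries of the pair `(Δ, Γ)` in dimension `n - 1`: boundaries of chains of `Δ`,
up to chains of `Γ`. -/
def relBoundaries (K : Type*) [Field K] (κ : V → Fin d) (Δ Γ : Finset (Finset V)) (n : ℕ) :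
    Submodule K (Finset V →₀ K) :=
  (chains K Δ (n + 1)).map (boundary K κ) ⊔ chains K Γ n

/-- The quotient `Z / B` of a submodule `Z` by a submodule `B ⊆ Z`. -/
abbrev Subquotient {K M : Type*} [Field K] [AddCommGroup M] [Module K M] (Z B : Submodule K M) :
    Type _ :=
  Z ⧸ B.submoduleOf Z

/-- The reduced relative simplicial homology of the pair `(Δ, Γ)` in dimension `n - 1`, with
coefficients in the field `K`. The index `n` is the number of vertices of the faces involved. -/
abbrev RelHomology (K : Type*) [Field K] (κ : V → Fin d)
    (Δ Γ : Finset (Finset V)) (n : ℕ) : Type _ :=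
  Subquotient (relCycles K κ Δ Γ n) (relBoundaries K κ Δ Γ n)

/-- The simplicial complex `Δ` of all subsets of faces of `Φ`. -/
def outer (Φ : BalancedRelComplex V d) : Finset (Finset V) :=
  Φ.faces.biUnion Finset.powerset

/-- The simplicial complex `Γ = Δ \ Φ`, so that `(Δ, Γ)` is a presentation of `Φ`. -/
def inner (Φ : BalancedRelComplex V d) : Finset (Finset V) :=
  Φ.outer \ Φ.faces

/-- Serre's condition `(S_ℓ)`: for all `σ ∈ Δ` and all `n ≤ min (dim lk_Φ σ) (ℓ - 1)`, the
reduced homology, with complex coefficients, of the pair `(lk_Δ σ, lk_Γ σ)` in dimension `n - 1`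
vanishes. Negative `n` give no condition, since there are no faces of dimension less than `-1`. -/
def SatisfiesSerre (Φ : BalancedRelComplex V d) (l : ℕ) : Prop :=
  ∀ σ ∈ Φ.outer, ∀ n : ℕ,
    (n : ℤ) ≤ min (dim (link Φ.outer σ \ link Φ.inner σ)) ((l : ℤ) - 1) →
      Subsingleton (RelHomology ℂ Φ.color (link Φ.outer σ) (link Φ.inner σ) n)

end Homology

section Action

variable {V : Type*} [DecidableEq V] {d : ℕ}

/-- `G`, which acts on the vertex set, acts on `Φ`: it preserves the faces and the colors. -/
def IsActedOnBy (Φ : BalancedRelComplex V d) (G : Type*) [Group G] [MulAction G V] : Prop :=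
  (∀ (g : G), ∀ σ ∈ Φ.faces, g • σ ∈ Φ.faces) ∧ ∀ (g : G) (v : V), Φ.color (g • v) = Φ.color v

/-- The equivariant flag `f`-vector: the value of `f_S` at `g` is the number of faces with color
set `S` that are fixed by `g`. -/
def flagF (Φ : BalancedRelComplex V d) (G : Type*) [Group G] [MulAction G V]
    (S : Finset (Fin d)) : G → ℂ :=
  fun g => ((Φ.faces.filter (fun σ => σ.image Φ.color = S ∧ g • σ = σ)).card : ℂ)

/-- The equivariant flag `h`-vector, `h_S = ∑_{T ⊆ S} (-1) ^ |S \ T| f_T`. -/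
def flagH (Φ : BalancedRelComplex V d) (G : Type*) [Group G] [MulAction G V]
    (S : Finset (Fin d)) : G → ℂ :=
  ∑ T ∈ S.powerset, (-1 : ℂ) ^ (S \ T).card • Φ.flagF G T

/-- The equivariant `h`-vector, `h_i = ∑_{|S| = i} h_S`. -/
def hVector (Φ : BalancedRelComplex V d) (G : Type*) [Group G] [MulAction G V]
    (i : ℕ) : G → ℂ :=
  ∑ S ∈ Finset.powersetCard i (Finset.univ : Finset (Fin d)), Φ.flagH G S

end Action

end BalancedRelComplex

/-- `χ` is an effective character of `G`: the character of a (possibly zero) finite-dimensional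
complex representation. -/
def IsEffectiveCharacter {G : Type*} [Group G] (χ : G → ℂ) : Prop :=
  ∃ (m : ℕ) (ρ : Representation ℂ G (Fin m → ℂ)),
    ∀ g : G, χ g = LinearMap.trace ℂ (Fin m → ℂ) (ρ g)

end

/-! Orient every face by the order of its colors. The boundary of the relative chain complex of `Φ`
then splits into anticommuting operators `colorBoundary c`, one for each deleted color. Since the
group preserves colors, no signs twist its action: the chains form a permutation representation,
with character `flagF` in each color set, and every `colorBoundary c` is equivariant.

For disjoint `S` and `D`, let `topCycles S D` be the chains on color set `S ∪ D` killed by deletion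
of each color of `S`. Adjoining a color `c` to `S` cuts `topCycles S (insert c D)` down to the
kernel of `colorBoundary c`. As long as `S.card < l`, the image of that operator is all of
`topCycles S D` (`map_topCycles`), so characters subtract. By induction on `S`, for `S.card ≤ l` the
character of `topCycles S D` is the alternating sum of the `f_{T ∪ D}` over `T ⊆ S`, which equals
the sum of the `h_{S ∪ E}` over `E ⊆ D`. These interval sums are therefore effective; `D = ∅` gives
the first claim.

The surjectivity is an exactness statement. Serre's condition gives it for links with all colors
present (`SatisfiesSerre.linksExact_univ`), and colors can be discarded one at a time, the range of
degrees shrinking only at the top (`LinksExact.erase`).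

The second claim is then combinatorial. The required sum is a sum over `j`-sets `X` of weighted sums
of `h_T` over `T ⊆ X`, and Pascal's rule turns each of these into a sum of interval sums with
`S.card = l` (`isEffectiveCharacter_sum_shiftedChoose`). -/

noncomputable section

/-! ### Effective characters and additivity of the trace -/

section Characters

/-- A linear section `s` of `f` gives a projection `p` onto the kernel and writes `A` as a sum of
one map factoring through `p` and one factoring through `f`. Cyclicity of the trace moves the two
terms to the kernel and to `N`. -/
theorem LinearMap.trace_eq_trace_ker_add_trace {K M N : Type*} [Field K] [AddCommGroup M]
    [Module K M] [AddCommGroup N] [Module K N] [FiniteDimensional K M] [FiniteDimensional K N]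
    (f : M →ₗ[K] N) (hf : Function.Surjective f) (A : M →ₗ[K] M) (B : N →ₗ[K] N)
    (h : f ∘ₗ A = B ∘ₗ f) (hker : ∀ x ∈ LinearMap.ker f, A x ∈ LinearMap.ker f) :
    LinearMap.trace K M A
      = LinearMap.trace K (LinearMap.ker f) (A.restrict hker) + LinearMap.trace K N B := by
  obtain ⟨s, hs⟩ := f.exists_rightInverse_of_surjective (LinearMap.range_eq_top.2 hf)
  have hs' : ∀ y, f (s y) = y := fun y => LinearMap.congr_fun hs y
  let p : M →ₗ[K] LinearMap.ker f :=
    (LinearMap.id - s ∘ₗ f).codRestrict (LinearMap.ker f) (by intro x; simp [hs'])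
  have hA : A = (A ∘ₗ (LinearMap.ker f).subtype) ∘ₗ p + (A ∘ₗ s) ∘ₗ f := by
    ext x
    simp [p]
  have hr : p ∘ₗ (A ∘ₗ (LinearMap.ker f).subtype) = A.restrict hker := by
    ext x
    have : f (A x) = 0 := hker x x.2
    simp [p, this]
  have hB : f ∘ₗ (A ∘ₗ s) = B := by
    rw [← LinearMap.comp_assoc, h, LinearMap.comp_assoc, hs, LinearMap.comp_id]
  rw [← hr, ← hB, ← LinearMap.trace_comp_comm' p, ← LinearMap.trace_comp_comm' f (A ∘ₗ s), ← map_add,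
    ← hA]

variable {G : Type*} [Group G]

theorem isEffectiveCharacter_trace {W : Type*} [AddCommGroup W] [Module ℂ W]
    [FiniteDimensional ℂ W] (ρ : Representation ℂ G W) :
    IsEffectiveCharacter (fun g => LinearMap.trace ℂ W (ρ g)) := by
  let e : W ≃ₗ[ℂ] (Fin (Module.finrank ℂ W) → ℂ) :=
    (Module.finBasis ℂ W).equivFun
  refine ⟨Module.finrank ℂ W, (e.conjRingEquiv : Module.End ℂ W →*
    Module.End ℂ (Fin (Module.finrank ℂ W) → ℂ)).comp ρ, fun g => ?_⟩
  exact (LinearMap.trace_conj' (ρ g) e).symm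

theorem IsEffectiveCharacter.zero : IsEffectiveCharacter (0 : G → ℂ) :=
  ⟨0, 1, fun g => by simp⟩

theorem IsEffectiveCharacter.add {χ ψ : G → ℂ} (hχ : IsEffectiveCharacter χ)
    (hψ : IsEffectiveCharacter ψ) : IsEffectiveCharacter (χ + ψ) := by
  obtain ⟨m, ρ, hρ⟩ := hχ
  obtain ⟨n, σ, hσ⟩ := hψ
  have h := isEffectiveCharacter_trace (ρ.prod σ)
  convert h using 1
  funext g
  rw [Pi.add_apply, hρ, hσ, ← LinearMap.trace_prodMap']
  rfl

theorem IsEffectiveCharacter.sum {ι : Type*} (s : Finset ι) (χ : ι → G → ℂ)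
    (h : ∀ i ∈ s, IsEffectiveCharacter (χ i)) : IsEffectiveCharacter (∑ i ∈ s, χ i) :=
  Finset.sum_induction χ IsEffectiveCharacter (fun _ _ => IsEffectiveCharacter.add)
    IsEffectiveCharacter.zero h

variable {E : Type*} [AddCommGroup E] [Module ℂ E]

/-- The submodule `W` is finite-dimensional and invariant under `ρ`, and `χ` is the character of
the resulting representation on `W`. -/
def HasCharacter (ρ : Representation ℂ G E) (W : Submodule ℂ E) (χ : G → ℂ) : Prop :=
  FiniteDimensional ℂ W ∧ ∃ h : ∀ g, ∀ x ∈ W, ρ g x ∈ W,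
    ∀ g, χ g = LinearMap.trace ℂ W ((ρ g).restrict (h g))

theorem HasCharacter.isEffectiveCharacter {ρ : Representation ℂ G E} {W : Submodule ℂ E}
    {χ : G → ℂ} (hW : HasCharacter ρ W χ) : IsEffectiveCharacter χ := by
  obtain ⟨_, h, hχ⟩ := hW
  have := isEffectiveCharacter_trace (ρ.subrepresentation W h)
  convert this using 1
  funext g
  exact hχ g

/-- Additivity of the trace along the exact sequence `0 → W ⊓ ker f → W → W' → 0`. This is what
makes a difference of characters effective. -/
theorem HasCharacter.inf_ker {ρ : Representation ℂ G E} {W W' : Submodule ℂ E}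
    {χ χ' : G → ℂ} (hW : HasCharacter ρ W χ) (hW' : HasCharacter ρ W' χ') (f : E →ₗ[ℂ] E)
    (hf : ∀ g, f ∘ₗ ρ g = ρ g ∘ₗ f) (hmap : W.map f = W') :
    HasCharacter ρ (W ⊓ LinearMap.ker f) (χ - χ') := by
  obtain ⟨hfin, hinv, hχ⟩ := hW
  obtain ⟨hfin', hinv', hχ'⟩ := hW'
  have hf' : ∀ g x, f (ρ g x) = ρ g (f x) := fun g x => LinearMap.congr_fun (hf g) x
  have hinvk : ∀ g, ∀ x ∈ W ⊓ LinearMap.ker f, ρ g x ∈ W ⊓ LinearMap.ker f := by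
    rintro g x ⟨hx, hx'⟩
    refine ⟨hinv g x hx, ?_⟩
    rw [SetLike.mem_coe, LinearMap.mem_ker] at hx' ⊢
    rw [hf', hx', map_zero]
  refine ⟨Submodule.finiteDimensional_inf_left _ _, hinvk, fun g => ?_⟩
  have hfW : ∀ x ∈ W, f x ∈ W' := fun x hx => hmap ▸ Submodule.mem_map_of_mem hx
  have hsurj : Function.Surjective (f.restrict hfW) := by
    rintro ⟨y, hy⟩
    obtain ⟨x, hx, rfl⟩ := Submodule.mem_map.1 (hmap.symm ▸ hy)
    exact ⟨⟨x, hx⟩, rfl⟩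
  have hcomm : f.restrict hfW ∘ₗ (ρ g).restrict (hinv g)
      = (ρ g).restrict (hinv' g) ∘ₗ f.restrict hfW := by
    ext x
    exact hf' g x
  have hk : ∀ x ∈ LinearMap.ker (f.restrict hfW),
      (ρ g).restrict (hinv g) x ∈ LinearMap.ker (f.restrict hfW) := by
    intro x hx
    rw [LinearMap.mem_ker] at hx ⊢
    have := LinearMap.congr_fun hcomm x
    simp only [LinearMap.comp_apply] at this
    rw [this, hx, map_zero]
  have key := LinearMap.trace_eq_trace_ker_add_trace _ hsurj _ _ hcomm hk
  let e : LinearMap.ker (f.restrict hfW) ≃ₗ[ℂ] (W ⊓ LinearMap.ker f : Submodule ℂ E) :=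
    { toFun := fun x => ⟨x.1.1, x.1.2, congrArg Subtype.val (LinearMap.mem_ker.1 x.2)⟩
      invFun := fun x => ⟨⟨x.1, x.2.1⟩, LinearMap.mem_ker.2 (Subtype.ext x.2.2)⟩
      map_add' := fun _ _ => rfl
      map_smul' := fun _ _ => rfl
      left_inv := fun _ => rfl
      right_inv := fun _ => rfl }
  have he : (ρ g).restrict (hinvk g) = e.conj (((ρ g).restrict (hinv g)).restrict hk) := by
    ext x
    rfl
  rw [he, LinearMap.trace_conj', Pi.sub_apply, hχ g, hχ' g, key, add_sub_cancel_right]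

end Characters

/-! ### Permutation representations on finitely supported functions -/

section Permutation

variable {G : Type*} [Group G] {X : Type*} [MulAction G X]

/-- The permutation representation on the finitely supported functions on a `G`-set. -/
def finsuppRep (G : Type*) [Group G] (X : Type*) [MulAction G X] :
    Representation ℂ G (X →₀ ℂ) where
  toFun g := Finsupp.lmapDomain ℂ ℂ (g • ·)
  map_one' := by ext; simp
  map_mul' g h := by ext; simp [mul_smul]

@[simp]
theorem finsuppRep_single (g : G) (x : X) (a : ℂ) :
    finsuppRep G X g (Finsupp.single x a) = Finsupp.single (g • x) a := by
  simp [finsuppRep]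

theorem finsuppRep_mem_supported {s : Set X} (hs : ∀ (g : G), ∀ x ∈ s, g • x ∈ s) (g : G)
    {z : X →₀ ℂ} (hz : z ∈ Finsupp.supported ℂ ℂ s) :
    finsuppRep G X g z ∈ Finsupp.supported ℂ ℂ s := by
  classical
  rw [Finsupp.mem_supported] at hz ⊢
  intro x hx
  obtain ⟨y, hy, rfl⟩ := Finset.mem_image.1 (Finsupp.mapDomain_support hx)
  exact hs g y (hz hy)

/-- In the basis of point masses the diagonal entry at `x` is 1 or 0 according to whether `g` fixes
`x`. -/
theorem hasCharacter_supported [DecidableEq X] (s : Finset X)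
    (hs : ∀ (g : G), ∀ x ∈ s, g • x ∈ s) :
    HasCharacter (finsuppRep G X) (Finsupp.supported ℂ ℂ (s : Set X))
      (fun g => ((s.filter (fun x => g • x = x)).card : ℂ)) := by
  let e := Finsupp.supportedEquivFinsupp (M := ℂ) (R := ℂ) (s : Set X)
  let b : Module.Basis s ℂ (Finsupp.supported ℂ ℂ (s : Set X)) := Module.Basis.ofRepr e
  have hb : ∀ i : s, ((b i : Finsupp.supported ℂ ℂ (s : Set X)) : X →₀ ℂ)
      = Finsupp.single (i : X) 1 := by
    intro i
    exact Finsupp.supportedEquivFinsupp_symm_single (s : Set X) i (1 : ℂ)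
  refine ⟨Module.Finite.of_basis b,
    fun g x hx => finsuppRep_mem_supported (fun g x hx => hs g x hx) g hx, fun g => ?_⟩
  rw [LinearMap.trace_eq_matrix_trace ℂ b, Matrix.trace]
  have hd : ∀ i : s, (LinearMap.toMatrix b b ((finsuppRep G X g).restrict
      (fun x hx => finsuppRep_mem_supported (fun g x hx => hs g x hx) g hx))).diag i
      = if g • (i : X) = i then 1 else 0 := by
    intro i
    rw [Matrix.diag_apply, LinearMap.toMatrix_apply]
    change ((((finsuppRep G X g).restrict _) (b i)).1 : X →₀ ℂ) (i : X) = _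
    rw [LinearMap.coe_restrict_apply, hb, finsuppRep_single, Finsupp.single_apply]
  rw [Finset.sum_congr rfl fun i _ => hd i]
  simp only [Finset.card_filter, Nat.cast_sum, Nat.cast_ite, Nat.cast_one, Nat.cast_zero]
  exact (Finset.sum_coe_sort s (fun x => if g • x = x then (1 : ℂ) else 0)).symm

end Permutation

namespace BalancedRelComplex

/-! ### Signs of the color orientation -/

section FaceSign

variable {V : Type*} {d : ℕ}

/-- The sign with which `σ.erase v` occurs in the boundary of `σ`. -/
def faceSign (κ : V → Fin d) (σ : Finset V) (v : V) : ℂ :=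
  (-1) ^ (σ.filter (fun w => κ w < κ v)).card

theorem faceSign_mul_self (κ : V → Fin d) (σ : Finset V) (v : V) :
    faceSign κ σ v * faceSign κ σ v = 1 := by
  rw [faceSign, ← mul_pow]
  simp

/-- The sign relating the orientation of `τ` in the link of `σ` to that of `τ ∪ σ`. -/
def joinSign (κ : V → Fin d) (σ τ : Finset V) : ℂ :=
  ∏ v ∈ τ, faceSign κ σ v

theorem joinSign_mul_self (κ : V → Fin d) (σ τ : Finset V) :
    joinSign κ σ τ * joinSign κ σ τ = 1 := by
  rw [joinSign, ← Finset.prod_mul_distrib]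
  exact Finset.prod_eq_one fun v _ => faceSign_mul_self κ σ v

end FaceSign

/-! ### Splitting the relative boundary by deleted color -/

section ColorBoundary

variable {V : Type*} [DecidableEq V] {d : ℕ} (Φ : BalancedRelComplex V d)

/-- The part of the relative boundary map of `Φ` that deletes the vertex of color `c`. -/
def colorBoundary (c : Fin d) : (Finset V →₀ ℂ) →ₗ[ℂ] (Finset V →₀ ℂ) :=
  Finsupp.linearCombination ℂ (fun σ : Finset V =>
    if σ ∈ Φ.faces then
      ∑ v ∈ σ.filter (fun v => Φ.color v = c),
        if σ.erase v ∈ Φ.faces then Finsupp.single (σ.erase v) (faceSign Φ.color σ v) else 0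
    else 0)

variable {Φ}

theorem color_injOn {σ : Finset V} (hσ : σ ∈ Φ.faces) : Set.InjOn Φ.color (σ : Set V) :=
  Finset.card_image_iff.1 (Φ.rainbow σ hσ)

theorem image_color_erase {σ : Finset V} (hσ : σ ∈ Φ.faces) {v : V} (hv : v ∈ σ) :
    (σ.erase v).image Φ.color = (σ.image Φ.color).erase (Φ.color v) := by
  have h := color_injOn hσ
  ext c
  simp only [Finset.mem_image, Finset.mem_erase]
  constructor
  · rintro ⟨w, ⟨hwv, hw⟩, rfl⟩
    exact ⟨fun e => hwv (h hw hv e), w, hw, rfl⟩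
  · rintro ⟨hc, w, hw, rfl⟩
    exact ⟨w, ⟨fun e => hc (e ▸ rfl), hw⟩, rfl⟩

theorem colorBoundary_single {σ : Finset V} (hσ : σ ∈ Φ.faces) {v : V} (hv : v ∈ σ) (a : ℂ) :
    Φ.colorBoundary (Φ.color v) (Finsupp.single σ a) =
      if σ.erase v ∈ Φ.faces then Finsupp.single (σ.erase v) (a * faceSign Φ.color σ v)
      else 0 := by
  have : σ.filter (fun w => Φ.color w = Φ.color v) = {v} := by
    ext w
    simp only [Finset.mem_filter, Finset.mem_singleton]
    exact ⟨fun h => color_injOn hσ h.1 hv h.2, by rintro rfl; exact ⟨hv, rfl⟩⟩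
  rw [colorBoundary, Finsupp.linearCombination_single, if_pos hσ, this, Finset.sum_singleton,
    smul_ite, Finsupp.smul_single, smul_zero, smul_eq_mul]

theorem colorBoundary_single_of_color {σ : Finset V} {c : Fin d} (hc : c ∉ σ.image Φ.color)
    (a : ℂ) : Φ.colorBoundary c (Finsupp.single σ a) = 0 := by
  have : σ.filter (fun w => Φ.color w = c) = ∅ := by
    ext w
    simp only [Finset.mem_filter, Finset.notMem_empty, iff_false]
    exact fun h => hc (Finset.mem_image.2 ⟨w, h⟩)
  simp [colorBoundary, this]

theorem colorBoundary_single_of_notMem {σ : Finset V} (hσ : σ ∉ Φ.faces) (c : Fin d) (a : ℂ) :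
    Φ.colorBoundary c (Finsupp.single σ a) = 0 := by
  simp [colorBoundary, hσ]

theorem faceSign_erase_of_lt (κ : V → Fin d) {σ : Finset V} {v w : V} (hv : v ∈ σ)
    (h : κ v < κ w) : faceSign κ (σ.erase v) w = - faceSign κ σ w := by
  have : σ.filter (fun u => κ u < κ w)
      = insert v ((σ.erase v).filter (fun u => κ u < κ w)) := by
    ext u
    simp only [Finset.mem_filter, Finset.mem_insert, Finset.mem_erase]
    by_cases huv : u = v
    · simp [huv, hv, h]
    · simp [huv]
  rw [faceSign, faceSign, this, Finset.card_insert_of_notMem (by simp), pow_succ]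
  ring

theorem faceSign_erase_of_le (κ : V → Fin d) {σ : Finset V} {v w : V}
    (h : κ w ≤ κ v) : faceSign κ (σ.erase v) w = faceSign κ σ w := by
  rw [faceSign, faceSign]
  congr 2
  ext u
  simp only [Finset.mem_filter, Finset.mem_erase]
  exact ⟨fun hu => ⟨hu.1.2, hu.2⟩, fun hu => ⟨⟨fun e => (e ▸ hu.2).not_ge h, hu.1⟩, hu.2⟩⟩

theorem faceSign_erase_mul (κ : V → Fin d) {σ : Finset V} {v w : V} (hv : v ∈ σ) (hw : w ∈ σ)
    (h : κ v ≠ κ w) :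
    faceSign κ σ v * faceSign κ (σ.erase v) w = -(faceSign κ σ w * faceSign κ (σ.erase w) v) := by
  rcases lt_or_gt_of_ne h with h | h
  · rw [faceSign_erase_of_lt κ hv h, faceSign_erase_of_le κ h.le]
    ring
  · rw [faceSign_erase_of_lt κ hw h, faceSign_erase_of_le κ h.le]
    ring

variable (Φ) in
-- Deleting two vertices in either order reaches the same face with opposite signs, because the
-- deletion of the vertex of smaller color flips the sign of the other one. Equal colors give zero
-- on both sides, since a face has at most one vertex of each color.
theorem colorBoundary_anticomm (c c' : Fin d) :
    Φ.colorBoundary c ∘ₗ Φ.colorBoundary c' = -(Φ.colorBoundary c' ∘ₗ Φ.colorBoundary c) := by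
  refine Finsupp.lhom_ext fun σ a => ?_
  rw [LinearMap.neg_apply, LinearMap.comp_apply, LinearMap.comp_apply]
  by_cases hσ : σ ∈ Φ.faces
  swap
  · simp [colorBoundary_single_of_notMem hσ]
  have key : ∀ c₁ c₂, c₁ ∉ σ.image Φ.color →
      Φ.colorBoundary c₁ (Φ.colorBoundary c₂ (Finsupp.single σ a)) = 0 := by
    intro c₁ c₂ h₁
    by_cases h₂ : c₂ ∈ σ.image Φ.color
    swap
    · rw [colorBoundary_single_of_color h₂, map_zero]
    obtain ⟨v, hv, rfl⟩ := Finset.mem_image.1 h₂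
    rw [colorBoundary_single hσ hv]
    split_ifs with hf
    · refine colorBoundary_single_of_color (fun h => h₁ ?_) _
      exact Finset.image_subset_image (Finset.erase_subset _ _) h
    · exact map_zero _
  by_cases hc : c ∈ σ.image Φ.color
  swap
  · rw [key c c' hc, colorBoundary_single_of_color hc, map_zero, neg_zero]
  by_cases hc' : c' ∈ σ.image Φ.color
  swap
  · rw [key c' c hc', colorBoundary_single_of_color hc', map_zero, neg_zero]
  obtain ⟨v, hv, rfl⟩ := Finset.mem_image.1 hc
  obtain ⟨w, hw, rfl⟩ := Finset.mem_image.1 hc'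
  by_cases hvw : v = w
  · subst hvw
    have : Φ.colorBoundary (Φ.color v) (Φ.colorBoundary (Φ.color v) (Finsupp.single σ a)) = 0 := by
      rw [colorBoundary_single hσ hv]
      split_ifs
      · refine colorBoundary_single_of_color ?_ _
        rw [image_color_erase hσ hv]
        exact Finset.notMem_erase _ _
      · exact map_zero _
    rw [this, neg_zero]
  have hne : Φ.color v ≠ Φ.color w := fun h => hvw (color_injOn hσ hv hw h)
  have hw' : w ∈ σ.erase v := Finset.mem_erase.2 ⟨Ne.symm hvw, hw⟩
  have hv' : v ∈ σ.erase w := Finset.mem_erase.2 ⟨hvw, hv⟩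
  have two : ∀ x y, x ∈ σ → y ∈ σ.erase x →
      Φ.colorBoundary (Φ.color y) (Φ.colorBoundary (Φ.color x) (Finsupp.single σ a)) =
        if (σ.erase x).erase y ∈ Φ.faces then Finsupp.single ((σ.erase x).erase y)
          (a * (faceSign Φ.color σ x * faceSign Φ.color (σ.erase x) y)) else 0 := by
    intro x y hx hy
    rw [colorBoundary_single hσ hx]
    by_cases hf : σ.erase x ∈ Φ.faces
    · rw [if_pos hf, colorBoundary_single hf hy, mul_assoc]
    -- Convexity of `Φ`: if `σ` and the doubly erased face lie in `Φ`, so does the intermediate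
    -- face. Hence the two orders of deletion survive or vanish together.
    · rw [if_neg hf, map_zero, if_neg]
      exact fun h => hf (Φ.convex _ _ _ (Finset.erase_subset _ _) (Finset.erase_subset _ _) h hσ)
  rw [two w v hw hv', two v w hv hw', faceSign_erase_mul _ hw hv hne.symm,
    Finset.erase_right_comm (a := w)]
  split_ifs
  · rw [← Finsupp.single_neg, mul_neg]
  · rw [neg_zero]

theorem colorBoundary_anticomm_apply (c c' : Fin d) (z : Finset V →₀ ℂ) :
    Φ.colorBoundary c (Φ.colorBoundary c' z) = -Φ.colorBoundary c' (Φ.colorBoundary c z) :=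
  LinearMap.congr_fun (Φ.colorBoundary_anticomm c c') z

theorem mem_of_linearMap_supported {α M : Type*} [AddCommGroup M] [Module ℂ M]
    (f : (α →₀ ℂ) →ₗ[ℂ] M) {A : Set α} {N : Submodule ℂ M}
    (h : ∀ a ∈ A, f (Finsupp.single a 1) ∈ N) {z : α →₀ ℂ}
    (hz : z ∈ Finsupp.supported ℂ ℂ A) : f z ∈ N := by
  have : Finsupp.supported ℂ ℂ A ≤ N.comap f := by
    rw [Finsupp.supported_eq_span_single, Submodule.span_le]
    rintro _ ⟨a, ha, rfl⟩
    exact h a ha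
  exact this hz

theorem eq_of_linearMap_supported {α M : Type*} [AddCommGroup M] [Module ℂ M]
    (f g : (α →₀ ℂ) →ₗ[ℂ] M) {A : Set α}
    (h : ∀ a ∈ A, f (Finsupp.single a 1) = g (Finsupp.single a 1)) {z : α →₀ ℂ}
    (hz : z ∈ Finsupp.supported ℂ ℂ A) : f z = g z := by
  have := mem_of_linearMap_supported (f - g) (N := ⊥) (A := A)
    (fun a ha => by simpa [sub_eq_zero] using h a ha) hz
  simpa [sub_eq_zero] using this

theorem colorBoundary_mem_supported {A B : Set (Finset V)} {c : Fin d}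
    (h : ∀ σ ∈ A, σ ∈ Φ.faces → ∀ v ∈ σ, Φ.color v = c → σ.erase v ∈ Φ.faces → σ.erase v ∈ B)
    {z : Finset V →₀ ℂ} (hz : z ∈ Finsupp.supported ℂ ℂ A) :
    Φ.colorBoundary c z ∈ Finsupp.supported ℂ ℂ B := by
  refine mem_of_linearMap_supported _ (fun σ hσ => ?_) hz
  by_cases hf : σ ∈ Φ.faces
  swap
  · rw [colorBoundary_single_of_notMem hf]
    exact zero_mem _
  by_cases hc : c ∈ σ.image Φ.color
  swap
  · rw [colorBoundary_single_of_color hc]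
    exact zero_mem _
  obtain ⟨v, hv, rfl⟩ := Finset.mem_image.1 hc
  rw [colorBoundary_single hf hv]
  split_ifs with h'
  · exact Finsupp.single_mem_supported ℂ _ (h σ hσ hf v hv rfl h')
  · exact zero_mem _

theorem colorBoundary_eq_zero {A : Set (Finset V)} {c : Fin d}
    (h : ∀ σ ∈ A, c ∉ σ.image Φ.color)
    {z : Finset V →₀ ℂ} (hz : z ∈ Finsupp.supported ℂ ℂ A) : Φ.colorBoundary c z = 0 := by
  have := mem_of_linearMap_supported (Φ.colorBoundary c) (N := ⊥)
    (fun σ hσ => (Submodule.mem_bot ℂ).2 (colorBoundary_single_of_color (h σ hσ) 1)) hz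
  exact (Submodule.mem_bot ℂ).1 this

variable (Φ) in
/-- The boundary map of the links of the faces with color set `D`: it deletes the vertices whose
color does not belong to `D`. -/
def linkBoundary (D : Finset (Fin d)) : (Finset V →₀ ℂ) →ₗ[ℂ] (Finset V →₀ ℂ) :=
  ∑ c ∈ Dᶜ, Φ.colorBoundary c

theorem linkBoundary_apply (D : Finset (Fin d)) (z : Finset V →₀ ℂ) :
    Φ.linkBoundary D z = ∑ c ∈ Dᶜ, Φ.colorBoundary c z := by
  rw [linkBoundary, LinearMap.sum_apply]

theorem linkBoundary_linkBoundary (D : Finset (Fin d)) (z : Finset V →₀ ℂ) :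
    Φ.linkBoundary D (Φ.linkBoundary D z) = 0 := by
  simp only [linkBoundary_apply, map_sum]
  -- Exchanging the two summation indices and anticommuting shows that the double sum equals its own
  -- negative.
  refine self_eq_neg.1 ?_
  conv_rhs => rw [Finset.sum_comm]
  simp only [← Finset.sum_neg_distrib]
  exact Finset.sum_congr rfl fun c _ => Finset.sum_congr rfl fun c' _ =>
    colorBoundary_anticomm_apply _ _ _

theorem linkBoundary_insert {D : Finset (Fin d)} {c : Fin d} (hc : c ∉ D) (z : Finset V →₀ ℂ) :
    Φ.linkBoundary D z = Φ.colorBoundary c z + Φ.linkBoundary (insert c D) z := by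
  rw [linkBoundary_apply, linkBoundary_apply, Finset.compl_insert,
    Finset.add_sum_erase _ (fun c => Φ.colorBoundary c z) (Finset.mem_compl.2 hc)]

end ColorBoundary

/-! ### Equivariance of the color boundaries -/

section Equivariance

variable {V : Type*} [DecidableEq V] {d : ℕ} {Φ : BalancedRelComplex V d}
  {G : Type*} [Group G] [MulAction G V]

theorem IsActedOnBy.smul_mem_iff (hG : Φ.IsActedOnBy G) (g : G) (σ : Finset V) :
    g • σ ∈ Φ.faces ↔ σ ∈ Φ.faces :=
  ⟨fun h => by simpa using hG.1 g⁻¹ _ h, hG.1 g σ⟩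

theorem IsActedOnBy.image_color_smul (hG : Φ.IsActedOnBy G) (g : G) (σ : Finset V) :
    (g • σ).image Φ.color = σ.image Φ.color := by
  rw [← Finset.image_smul, Finset.image_image]
  exact Finset.image_congr fun v _ => hG.2 g v

theorem IsActedOnBy.faceSign_smul (hG : Φ.IsActedOnBy G) (g : G) (σ : Finset V) (v : V) :
    faceSign Φ.color (g • σ) (g • v) = faceSign Φ.color σ v := by
  rw [faceSign, faceSign, ← Finset.image_smul, Finset.filter_image,
    Finset.card_image_of_injective _ (MulAction.injective g)]
  simp only [hG.2]

theorem IsActedOnBy.colorBoundary_comp (hG : Φ.IsActedOnBy G) (g : G) (c : Fin d) :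
    Φ.colorBoundary c ∘ₗ finsuppRep G (Finset V) g
      = finsuppRep G (Finset V) g ∘ₗ Φ.colorBoundary c := by
  refine Finsupp.lhom_ext fun σ a => ?_
  rw [LinearMap.comp_apply, LinearMap.comp_apply, finsuppRep_single]
  by_cases hσ : σ ∈ Φ.faces
  swap
  · rw [colorBoundary_single_of_notMem hσ,
      colorBoundary_single_of_notMem (by rwa [hG.smul_mem_iff]), map_zero]
  by_cases hc : c ∈ σ.image Φ.color
  swap
  · rw [colorBoundary_single_of_color hc,
      colorBoundary_single_of_color (by rwa [hG.image_color_smul]), map_zero]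
  obtain ⟨v, hv, rfl⟩ := Finset.mem_image.1 hc
  have he : (g • σ).erase (g • v) = g • σ.erase v := by
    rw [← Finset.image_smul, ← Finset.image_smul, Finset.image_erase (MulAction.injective g)]
  rw [colorBoundary_single hσ hv, ← hG.2 g v,
    colorBoundary_single (hG.1 g σ hσ) (Finset.smul_mem_smul_finset hv), he,
    hG.faceSign_smul]
  simp only [hG.smul_mem_iff]
  split_ifs
  · rw [finsuppRep_single]
  · rw [map_zero]

end Equivariance

/-! ### Exactness of links under rank selection -/

section Exactness

variable {V : Type*} [DecidableEq V] {d : ℕ} {Φ : BalancedRelComplex V d}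

variable (Φ) in
/-- The chains of `Φ` on the faces with `D.card + n` vertices whose color set lies between `D`
and `X`. -/
def chainsBetween (X D : Finset (Fin d)) (n : ℕ) : Submodule ℂ (Finset V →₀ ℂ) :=
  Finsupp.supported ℂ ℂ {σ | σ ∈ Φ.faces ∧ D ⊆ σ.image Φ.color ∧ σ.image Φ.color ⊆ X ∧
    σ.card = D.card + n}

variable (Φ) in
/-- The direct sum of the rank-selected links of the faces with color set `D` has no homology in
degrees below `l` and below the top degree. -/
def LinksExact (l : ℕ) (X D : Finset (Fin d)) : Prop :=
  ∀ n < l, D.card + n < X.card → ∀ z ∈ Φ.chainsBetween X D n, Φ.linkBoundary D z = 0 →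
    ∃ y ∈ Φ.chainsBetween X D (n + 1), Φ.linkBoundary D y = z

/-- A filling `y` of `z` found in `X` may use the color `c`. Let `y₁` be the part of `y` that does.
Among the terms of the boundary equation only `linkBoundary (insert c D) y₁` lives on faces with
color `c`, so it vanishes. Exactness over `insert c D` then fills `y₁`, and the filling corrects `y`
to a chain avoiding `c`. -/
theorem LinksExact.erase {l : ℕ} {X D : Finset (Fin d)} {c : Fin d} (hcX : c ∈ X) (hcD : c ∉ D)
    (h : Φ.LinksExact l X D) (h' : Φ.LinksExact l X (insert c D)) :
    Φ.LinksExact l (X.erase c) D := by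
  intro n hn hcard z hz hz0
  rw [Finset.card_erase_of_mem hcX] at hcard
  have hDc : (insert c D).card = D.card + 1 := Finset.card_insert_of_notMem hcD
  let N : Set (Finset V) := {σ | c ∉ σ.image Φ.color}
  let Y : Set (Finset V) := {σ | c ∈ σ.image Φ.color}
  have hzN : z ∈ Finsupp.supported ℂ ℂ N := by
    refine Finsupp.supported_mono ?_ hz
    rintro σ ⟨-, -, hσ, -⟩ hc
    exact Finset.notMem_erase c X (hσ hc)
  obtain ⟨y, hy, rfl⟩ := h n hn (by omega) z
    (Finsupp.supported_mono (by
      rintro σ ⟨h₁, h₂, h₃, h₄⟩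
      exact ⟨h₁, h₂, h₃.trans (Finset.erase_subset _ _), h₄⟩) hz) hz0
  let y₀ := y.filter (fun σ => c ∉ σ.image Φ.color)
  let y₁ := y.filter (fun σ => c ∈ σ.image Φ.color)
  have hsplit : y = y₀ + y₁ := by
    rw [add_comm]
    exact (Finsupp.filter_add_filter_not y (fun σ => c ∈ σ.image Φ.color)).symm
  have hy₀ : y₀ ∈ Φ.chainsBetween (X.erase c) D (n + 1) := by
    intro σ hσ
    rw [Finset.mem_coe, Finsupp.support_filter, Finset.mem_filter] at hσ
    obtain ⟨h₁, h₂, h₃, h₄⟩ := hy hσ.1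
    exact ⟨h₁, h₂, Finset.subset_erase.2 ⟨h₃, hσ.2⟩, h₄⟩
  have hy₁ : y₁ ∈ Φ.chainsBetween X (insert c D) n := by
    intro σ hσ
    rw [Finset.mem_coe, Finsupp.support_filter, Finset.mem_filter] at hσ
    obtain ⟨h₁, h₂, h₃, h₄⟩ := hy hσ.1
    exact ⟨h₁, Finset.insert_subset hσ.2 h₂, h₃, by omega⟩
  have hN : ∀ e ∈ Dᶜ, Φ.colorBoundary e y₀ ∈ Finsupp.supported ℂ ℂ N := by
    intro e _
    refine colorBoundary_mem_supported (fun σ hσ hf v hv _ _ hc => ?_) hy₀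
    exact Finset.notMem_erase c X
      (hσ.2.2.1 (Finset.image_subset_image (Finset.erase_subset _ _) hc))
  have hcN : ∀ {m w}, w ∈ Φ.chainsBetween X (insert c D) m →
      Φ.colorBoundary c w ∈ Finsupp.supported ℂ ℂ N := by
    intro m w hw
    refine colorBoundary_mem_supported (fun σ hσ hf v hv hvc _ hc => ?_) hw
    rw [image_color_erase hf hv, hvc] at hc
    exact Finset.notMem_erase _ _ hc
  have hcY : Φ.linkBoundary (insert c D) y₁ ∈ Finsupp.supported ℂ ℂ Y := by
    rw [linkBoundary_apply]
    refine Submodule.sum_mem _ fun e he => ?_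
    refine colorBoundary_mem_supported (fun σ hσ hf v hv hve _ => ?_) hy₁
    change c ∈ (σ.erase v).image Φ.color
    rw [image_color_erase hf hv, hve]
    refine Finset.mem_erase.2 ⟨?_, hσ.2.1 (Finset.mem_insert_self _ _)⟩
    rintro rfl
    exact Finset.mem_compl.1 he (Finset.mem_insert_self _ _)
  have hcN' : Φ.linkBoundary (insert c D) y₁ ∈ Finsupp.supported ℂ ℂ N := by
    have : Φ.linkBoundary (insert c D) y₁
        = Φ.linkBoundary D y - Φ.linkBoundary D y₀ - Φ.colorBoundary c y₁ := by
      rw [hsplit, map_add, linkBoundary_insert hcD y₁]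
      abel
    rw [this]
    refine Submodule.sub_mem _ (Submodule.sub_mem _ hzN ?_) (hcN hy₁)
    rw [linkBoundary_apply]
    exact Submodule.sum_mem _ hN
  have hzero : Φ.linkBoundary (insert c D) y₁ = 0 := by
    have hdisj : Disjoint N Y := Set.disjoint_left.2 fun σ h₁ h₂ => h₁ h₂
    exact Submodule.disjoint_def.1 (Finsupp.disjoint_supported_supported hdisj) _ hcN' hcY
  obtain ⟨w, hw, hwy⟩ := h' n hn (by omega) y₁ hy₁ hzero
  -- Since `linkBoundary D w = colorBoundary c w + y₁`, this subtraction replaces `y₁` by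
  -- `-colorBoundary c w`, which avoids `c`, without changing the boundary.
  refine ⟨y - Φ.linkBoundary D w, ?_, ?_⟩
  · have : y - Φ.linkBoundary D w = y₀ - Φ.colorBoundary c w := by
      rw [linkBoundary_insert hcD, hwy, hsplit]
      abel
    rw [this]
    refine Submodule.sub_mem _ hy₀ ?_
    refine colorBoundary_mem_supported (fun σ hσ hf v hv hvc hf' => ?_) hw
    obtain ⟨-, h₂, h₃, h₄⟩ := hσ
    rw [hDc] at h₄
    refine ⟨hf', ?_, ?_, ?_⟩
    · rw [image_color_erase hf hv, hvc]
      exact Finset.subset_erase.2 ⟨(Finset.subset_insert _ _).trans h₂, hcD⟩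
    · rw [image_color_erase hf hv, hvc]
      exact Finset.erase_subset_erase _ h₃
    · rw [Finset.card_erase_of_mem hv]
      omega
  · rw [map_sub, linkBoundary_linkBoundary, sub_zero]

theorem LinksExact.of_univ {l : ℕ} (h : ∀ D, Φ.LinksExact l Finset.univ D)
    (X : Finset (Fin d)) : ∀ D ⊆ X, Φ.LinksExact l X D := by
  induction hX : Xᶜ using Finset.induction_on generalizing X with
  | empty =>
    rw [Finset.compl_eq_empty_iff] at hX
    exact fun D _ => hX ▸ h D
  | insert c A hc ih =>
    intro D hD
    have hcX : c ∉ X := by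
      rw [← Finset.mem_compl, hX]
      exact Finset.mem_insert_self _ _
    have hA : (insert c X)ᶜ = A := by
      rw [Finset.compl_insert, hX, Finset.erase_insert hc]
    have := LinksExact.erase (Finset.mem_insert_self c X) (fun h => hcX (hD h))
      (ih _ hA D (hD.trans (Finset.subset_insert _ _)))
      (ih _ hA (insert c D) (Finset.insert_subset_insert _ hD))
    rwa [Finset.erase_insert hcX] at this

end Exactness

/-! ### Top cycles and surjectivity of the color boundaries -/

section TopCycles

variable {V : Type*} [DecidableEq V] {d : ℕ} {Φ : BalancedRelComplex V d}

variable (Φ) in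
/-- The chains of `Φ` on the faces with color set `S ∪ D` that are killed by deleting the vertex of
any color in `S`. -/
def topCycles (S D : Finset (Fin d)) : Submodule ℂ (Finset V →₀ ℂ) :=
  Finsupp.supported ℂ ℂ (Φ.faces.filter (fun σ => σ.image Φ.color = S ∪ D) : Set (Finset V)) ⊓
    ⨅ c ∈ S, LinearMap.ker (Φ.colorBoundary c)

theorem mem_topCycles {S D : Finset (Fin d)} {z : Finset V →₀ ℂ} :
    z ∈ Φ.topCycles S D ↔ z ∈ Finsupp.supported ℂ ℂ
      (Φ.faces.filter (fun σ => σ.image Φ.color = S ∪ D) : Set (Finset V)) ∧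
      ∀ c ∈ S, Φ.colorBoundary c z = 0 := by
  simp [topCycles]

theorem topCycles_insert (S D : Finset (Fin d)) (c : Fin d) :
    Φ.topCycles (insert c S) D
      = Φ.topCycles S (insert c D) ⊓ LinearMap.ker (Φ.colorBoundary c) := by
  ext z
  rw [Submodule.mem_inf, mem_topCycles, mem_topCycles, LinearMap.mem_ker,
    Finset.insert_union, Finset.union_insert, Finset.forall_mem_insert]
  tauto

/-- An element of `topCycles S D` is a cycle for `linkBoundary D` in degree `S.card`, one below the
top degree for the colors `insert c (S ∪ D)`, so exactness fills it. Deleting different colors from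
the filling lands in different color sets, so the boundary equation separates: the `c`-component is
the given cycle and the components for colors in `S` vanish. -/
theorem map_topCycles {l : ℕ} {S D : Finset (Fin d)} {c : Fin d}
    (hSD : Disjoint S D) (hcS : c ∉ S) (hcD : c ∉ D) (hl : S.card < l)
    (h : Φ.LinksExact l (insert c (S ∪ D)) D) :
    (Φ.topCycles S (insert c D)).map (Φ.colorBoundary c) = Φ.topCycles S D := by
  have hc : c ∉ S ∪ D := by simp [hcS, hcD]
  have hcard : (S ∪ D).card = S.card + D.card := Finset.card_union_of_disjoint hSD
  have hcard' : (insert c (S ∪ D)).card = S.card + D.card + 1 := by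
    rw [Finset.card_insert_of_notMem hc, hcard]
  refine le_antisymm ?_ fun z hz => ?_
  · rintro _ ⟨y, hy, rfl⟩
    obtain ⟨hy₁, hy₂⟩ := mem_topCycles.1 hy
    refine mem_topCycles.2 ⟨colorBoundary_mem_supported (fun σ hσ hf v hv hvc hf' => ?_) hy₁,
      fun e he => ?_⟩
    · rw [Finset.mem_coe, Finset.mem_filter] at hσ ⊢
      rw [image_color_erase hf hv, hvc, hσ.2, Finset.union_insert, Finset.erase_insert hc]
      exact ⟨hf', rfl⟩
    · rw [colorBoundary_anticomm_apply, hy₂ e he, map_zero, neg_zero]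
  obtain ⟨hz₁, hz₂⟩ := mem_topCycles.1 hz
  have hz₀ : Φ.linkBoundary D z = 0 := by
    rw [linkBoundary_apply]
    refine Finset.sum_eq_zero fun e he => ?_
    by_cases heS : e ∈ S
    · exact hz₂ e heS
    · refine colorBoundary_eq_zero (fun σ hσ => ?_) hz₁
      rw [(Finset.mem_filter.1 (Finset.mem_coe.1 hσ)).2, Finset.mem_union]
      exact fun h' => h'.elim heS (Finset.mem_compl.1 he)
  obtain ⟨y, hy, hyz⟩ := h S.card hl (by omega) z
    (Finsupp.supported_mono (fun σ hσ => by
      rw [Finset.mem_coe, Finset.mem_filter] at hσ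
      refine ⟨hσ.1, ?_, ?_, ?_⟩
      · rw [hσ.2]
        exact Finset.subset_union_right
      · rw [hσ.2]
        exact Finset.subset_insert _ _
      · rw [← Φ.rainbow σ hσ.1, hσ.2]
        omega) hz₁) hz₀
  -- The faces of `y` have as many vertices as there are available colors, so they use all of them.
  have hy₁ : y ∈ Finsupp.supported ℂ ℂ
      (Φ.faces.filter (fun σ => σ.image Φ.color = insert c (S ∪ D)) : Set (Finset V)) := by
    refine Finsupp.supported_mono (fun σ hσ => ?_) hy
    obtain ⟨h₁, -, h₃, h₄⟩ := hσ
    rw [Finset.mem_coe, Finset.mem_filter]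
    refine ⟨h₁, Finset.eq_of_subset_of_card_le h₃ ?_⟩
    rw [Φ.rainbow σ h₁]
    omega
  have hpart : ∀ e, Φ.colorBoundary e y ∈ Finsupp.supported ℂ ℂ
      {σ | σ.image Φ.color = (insert c (S ∪ D)).erase e} := fun e =>
    colorBoundary_mem_supported (fun σ hσ hf v hv hve _ => by
      change (σ.erase v).image Φ.color = _
      rw [image_color_erase hf hv, hve,
        (Finset.mem_filter.1 (Finset.mem_coe.1 hσ)).2]) hy₁
  have hvanish : ∀ e ρ, ρ.image Φ.color ≠ (insert c (S ∪ D)).erase e →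
      Φ.colorBoundary e y ρ = 0 := fun e ρ hρ =>
    Finsupp.notMem_support_iff.1 fun hs => hρ (hpart e hs)
  have herase : ∀ e e', e ∈ insert c (S ∪ D) → e ≠ e' →
      (insert c (S ∪ D)).erase e ≠ (insert c (S ∪ D)).erase e' := by
    intro e e' he hne heq
    exact Finset.notMem_erase e (insert c (S ∪ D))
      (heq ▸ Finset.mem_erase.2 ⟨hne, he⟩)
  have hout : ∀ e, e ∉ insert c (S ∪ D) → Φ.colorBoundary e y = 0 := fun e he =>
    colorBoundary_eq_zero (fun σ hσ => by
      rwa [(Finset.mem_filter.1 (Finset.mem_coe.1 hσ)).2]) hy₁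
  have hcoord : ∀ e ∈ insert c (S ∪ D), e ∉ D → ∀ ρ,
      ρ.image Φ.color = (insert c (S ∪ D)).erase e → Φ.colorBoundary e y ρ = z ρ := by
    intro e he heD ρ hρ
    rw [← hyz, linkBoundary_apply, Finsupp.finsetSum_apply,
      Finset.sum_eq_single_of_mem e (Finset.mem_compl.2 heD)]
    intro e' _ hne
    exact hvanish e' ρ (hρ ▸ herase e e' he hne.symm)
  have hzc : ∀ ρ, ρ.image Φ.color ≠ (insert c (S ∪ D)).erase c → z ρ = 0 := by
    intro ρ hρ
    refine Finsupp.notMem_support_iff.1 fun hs => hρ ?_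
    rw [(Finset.mem_filter.1 (Finset.mem_coe.1 (hz₁ hs))).2, Finset.erase_insert hc]
  refine ⟨y, mem_topCycles.2 ⟨by rwa [Finset.union_insert], fun e he => ?_⟩, ?_⟩
  · have heX : e ∈ insert c (S ∪ D) := by simp [he]
    ext ρ
    by_cases hρ : ρ.image Φ.color = (insert c (S ∪ D)).erase e
    · rw [hcoord e heX (Finset.disjoint_left.1 hSD he) ρ hρ, Finsupp.zero_apply]
      refine hzc ρ (hρ ▸ herase e c heX ?_)
      rintro rfl
      exact hcS he
    · rw [hvanish e ρ hρ, Finsupp.zero_apply]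
  · ext ρ
    by_cases hρ : ρ.image Φ.color = (insert c (S ∪ D)).erase c
    · exact hcoord c (Finset.mem_insert_self _ _) hcD ρ hρ
    · rw [hvanish c ρ hρ, hzc ρ hρ]

end TopCycles

/-! ### From Serre's condition to exactness of links -/

section SerreCondition

variable {V : Type*} [DecidableEq V] {d : ℕ} {Φ : BalancedRelComplex V d}

theorem mem_outer {σ : Finset V} : σ ∈ Φ.outer ↔ ∃ τ ∈ Φ.faces, σ ⊆ τ := by
  simp [outer]

theorem mem_inner {σ : Finset V} : σ ∈ Φ.inner ↔ σ ∈ Φ.outer ∧ σ ∉ Φ.faces :=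
  Finset.mem_sdiff

theorem mem_outer_of_mem {σ : Finset V} (hσ : σ ∈ Φ.faces) : σ ∈ Φ.outer :=
  mem_outer.2 ⟨σ, hσ, Finset.Subset.refl σ⟩

theorem mem_outer_of_subset {σ τ : Finset V} (hτ : τ ∈ Φ.outer) (h : σ ⊆ τ) : σ ∈ Φ.outer :=
  let ⟨ρ, hρ, hτρ⟩ := mem_outer.1 hτ
  mem_outer.2 ⟨ρ, hρ, h.trans hτρ⟩

theorem mem_faces_of_subset {σ τ : Finset V} (hσ : σ ∈ Φ.faces) (hτ : τ ∈ Φ.outer)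
    (h : σ ⊆ τ) : τ ∈ Φ.faces :=
  let ⟨ρ, hρ, hτρ⟩ := mem_outer.1 hτ
  Φ.convex σ τ ρ h hτρ hσ hρ

theorem color_injOn_of_mem_outer {σ : Finset V} (hσ : σ ∈ Φ.outer) :
    Set.InjOn Φ.color (σ : Set V) :=
  let ⟨_, hρ, hσρ⟩ := mem_outer.1 hσ
  (color_injOn hρ).mono (Finset.coe_subset.2 hσρ)

theorem mem_link {Δ : Finset (Finset V)} {σ τ : Finset V} :
    τ ∈ link Δ σ ↔ τ ∈ Δ ∧ Disjoint τ σ ∧ τ ∪ σ ∈ Δ :=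
  Finset.mem_filter

theorem mem_link_outer {σ τ : Finset V} :
    τ ∈ link Φ.outer σ ↔ Disjoint τ σ ∧ τ ∪ σ ∈ Φ.outer :=
  mem_link.trans ⟨fun h => h.2, fun h =>
    ⟨mem_outer_of_subset h.2 Finset.subset_union_left, h⟩⟩

/-- Inside `Δ` the faces of `Φ` are closed upwards, so `τ ∪ σ ∉ Φ.faces` already forces `τ ∉
Φ.faces`. -/
theorem mem_link_inner {σ τ : Finset V} :
    τ ∈ link Φ.inner σ ↔ τ ∈ link Φ.outer σ ∧ τ ∪ σ ∉ Φ.faces := by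
  rw [mem_link_outer, mem_link, mem_inner, mem_inner]
  refine ⟨fun h => ⟨⟨h.2.1, h.2.2.1⟩, h.2.2.2⟩, fun h =>
    ⟨⟨mem_outer_of_subset h.1.2 Finset.subset_union_left, fun hτ => h.2 ?_⟩, h.1.1, h.1.2, h.2⟩⟩
  exact mem_faces_of_subset hτ h.1.2 Finset.subset_union_left

/-- By purity `σ` lies in a face of `Φ` with `d` vertices, and the rest of that face lies in the
relative link. -/
theorem card_le_dim_link {σ : Finset V} (hσ : σ ∈ Φ.outer) :
    (d : ℤ) - σ.card - 1 ≤ dim (link Φ.outer σ \ link Φ.inner σ) := by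
  obtain ⟨ρ, hρ, hσρ⟩ := mem_outer.1 hσ
  obtain ⟨τ, hτ, hρτ, hcard⟩ := Φ.pure ρ hρ
  have hστ := hσρ.trans hρτ
  have hmem : τ \ σ ∈ link Φ.outer σ \ link Φ.inner σ := by
    rw [Finset.mem_sdiff, mem_link_inner, mem_link_outer, Finset.sdiff_union_of_subset hστ]
    exact ⟨⟨Finset.sdiff_disjoint, mem_outer_of_mem hτ⟩, fun h => h.2 hτ⟩
  have hle := Finset.le_sup (f := Finset.card) hmem
  rw [Finset.card_sdiff_of_subset hστ] at hle
  have := Finset.card_le_card hστ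
  rw [dim]
  omega

theorem faceSign_union (κ : V → Fin d) {σ τ : Finset V} (h : Disjoint τ σ) (v : V) :
    faceSign κ (τ ∪ σ) v = faceSign κ τ v * faceSign κ σ v := by
  rw [faceSign, Finset.filter_union,
    Finset.card_union_of_disjoint (Finset.disjoint_filter_filter h), pow_add]
  rfl

variable (Φ) in
/-- Joining with `σ`, as a map from the chains of the link of `σ` to the relative chains of `Φ`. -/
def joinMap (σ : Finset V) : (Finset V →₀ ℂ) →ₗ[ℂ] (Finset V →₀ ℂ) :=
  Finsupp.linearCombination ℂ (fun τ : Finset V =>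
    if Disjoint τ σ ∧ τ ∪ σ ∈ Φ.faces then Finsupp.single (τ ∪ σ) (joinSign Φ.color σ τ) else 0)

variable (Φ) in
/-- Removing `σ` from the faces that contain it. -/
def unjoinMap (σ : Finset V) : (Finset V →₀ ℂ) →ₗ[ℂ] (Finset V →₀ ℂ) :=
  Finsupp.linearCombination ℂ (fun ρ : Finset V =>
    if σ ⊆ ρ then Finsupp.single (ρ \ σ) (joinSign Φ.color σ (ρ \ σ)) else 0)

theorem joinMap_single (σ τ : Finset V) (a : ℂ) :
    Φ.joinMap σ (Finsupp.single τ a) = if Disjoint τ σ ∧ τ ∪ σ ∈ Φ.faces then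
      Finsupp.single (τ ∪ σ) (a * joinSign Φ.color σ τ) else 0 := by
  rw [joinMap, Finsupp.linearCombination_single, smul_ite, Finsupp.smul_single, smul_zero,
    smul_eq_mul]

theorem unjoinMap_single (σ ρ : Finset V) (a : ℂ) :
    Φ.unjoinMap σ (Finsupp.single ρ a) = if σ ⊆ ρ then
      Finsupp.single (ρ \ σ) (a * joinSign Φ.color σ (ρ \ σ)) else 0 := by
  rw [unjoinMap, Finsupp.linearCombination_single, smul_ite, Finsupp.smul_single, smul_zero,
    smul_eq_mul]

theorem joinMap_unjoinMap_single (σ ρ : Finset V) (a : ℂ) :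
    Φ.joinMap σ (Φ.unjoinMap σ (Finsupp.single ρ a)) =
      if σ ⊆ ρ ∧ ρ ∈ Φ.faces then Finsupp.single ρ a else 0 := by
  rw [unjoinMap_single]
  by_cases h : σ ⊆ ρ
  · rw [if_pos h, joinMap_single, Finset.sdiff_union_of_subset h, mul_assoc, joinSign_mul_self,
      mul_one]
    simp [h, Finset.sdiff_disjoint]
  · simp [h]

/-- Joining with `σ` loses only chains of the link in `Γ`, so it is faithful on relative chains. -/
theorem sub_unjoinMap_joinMap_mem {σ : Finset V} {x : Finset V →₀ ℂ}
    (hx : x ∈ Finsupp.supported ℂ ℂ {τ : Finset V | τ ∈ link Φ.outer σ}) :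
    x - Φ.unjoinMap σ (Φ.joinMap σ x)
      ∈ Finsupp.supported ℂ ℂ {τ : Finset V | τ ∈ link Φ.inner σ} := by
  refine mem_of_linearMap_supported
    (LinearMap.id - Φ.unjoinMap σ ∘ₗ Φ.joinMap σ) (fun τ hτ => ?_) hx
  have hτ' := mem_link_outer.1 hτ
  rw [LinearMap.sub_apply, LinearMap.comp_apply, LinearMap.id_apply, joinMap_single]
  by_cases hf : τ ∪ σ ∈ Φ.faces
  · rw [if_pos ⟨hτ'.1, hf⟩, unjoinMap_single, if_pos Finset.subset_union_right,
      Finset.union_sdiff_cancel_right hτ'.1, mul_assoc, joinSign_mul_self, mul_one, sub_self]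
    exact zero_mem _
  · rw [if_neg (fun h => hf h.2), map_zero, sub_zero]
    exact Finsupp.single_mem_supported ℂ _ (mem_link_inner.2 ⟨hτ, hf⟩)

theorem linkBoundary_single {D : Finset (Fin d)} {ρ τ : Finset V} (hρ : ρ ∈ Φ.faces)
    (hτ : τ ⊆ ρ) (hD : ∀ v ∈ ρ, v ∈ τ ↔ Φ.color v ∉ D) (a : ℂ) :
    Φ.linkBoundary D (Finsupp.single ρ a) = ∑ v ∈ τ,
      if ρ.erase v ∈ Φ.faces then Finsupp.single (ρ.erase v) (a * faceSign Φ.color ρ v)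
      else 0 := by
  have hinj : Set.InjOn Φ.color (τ : Set V) := (color_injOn hρ).mono (Finset.coe_subset.2 hτ)
  have hsub : τ.image Φ.color ⊆ Dᶜ := by
    intro c hc
    obtain ⟨v, hv, rfl⟩ := Finset.mem_image.1 hc
    exact Finset.mem_compl.2 ((hD v (hτ hv)).1 hv)
  rw [linkBoundary_apply, ← Finset.sum_subset hsub, Finset.sum_image hinj]
  · exact Finset.sum_congr rfl fun v hv => colorBoundary_single hρ (hτ hv) a
  · intro c hc hc'
    refine colorBoundary_single_of_color (fun h => hc' ?_) a
    obtain ⟨v, hv, rfl⟩ := Finset.mem_image.1 h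
    exact Finset.mem_image_of_mem _ ((hD v hv).2 (Finset.mem_compl.1 hc))

/-- The sign of `v` in `τ ∪ σ` is its sign in `τ` times its sign against `σ`. The product `joinSign`
absorbs the second factor, which makes joining with `σ` a chain map. -/
theorem joinMap_boundary {σ : Finset V} {x : Finset V →₀ ℂ}
    (hx : x ∈ Finsupp.supported ℂ ℂ {τ : Finset V | τ ∈ link Φ.outer σ}) :
    Φ.joinMap σ (boundary ℂ Φ.color x)
      = Φ.linkBoundary (σ.image Φ.color) (Φ.joinMap σ x) := by
  refine eq_of_linearMap_supported (Φ.joinMap σ ∘ₗ boundary ℂ Φ.color)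
    (Φ.linkBoundary (σ.image Φ.color) ∘ₗ Φ.joinMap σ) (fun τ hτ => ?_) hx
  obtain ⟨hdisj, hout⟩ := mem_link_outer.1 hτ
  have herase : ∀ v ∈ τ, (τ ∪ σ).erase v = τ.erase v ∪ σ := by
    intro v hv
    rw [Finset.erase_union_distrib, Finset.erase_eq_of_notMem (Finset.disjoint_left.1 hdisj hv)]
  have hbd : boundary ℂ Φ.color (Finsupp.single τ 1)
      = ∑ v ∈ τ, Finsupp.single (τ.erase v) (faceSign Φ.color τ v) := by
    rw [boundary, Finsupp.linearCombination_single, one_smul]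
    rfl
  rw [LinearMap.comp_apply, LinearMap.comp_apply, hbd, map_sum, joinMap_single]
  simp only [joinMap_single]
  by_cases hf : τ ∪ σ ∈ Φ.faces
  · rw [if_pos ⟨hdisj, hf⟩, linkBoundary_single hf Finset.subset_union_left]
    · refine Finset.sum_congr rfl fun v hv => ?_
      have hd : Disjoint (τ.erase v) σ := hdisj.mono_left (Finset.erase_subset _ _)
      have hsign : faceSign Φ.color τ v * joinSign Φ.color σ (τ.erase v)
          = 1 * joinSign Φ.color σ τ * faceSign Φ.color (τ ∪ σ) v := by
        rw [faceSign_union _ hdisj, joinSign, joinSign, ← Finset.mul_prod_erase τ _ hv]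
        linear_combination (-(faceSign Φ.color τ v *
          ∏ u ∈ τ.erase v, faceSign Φ.color σ u)) * faceSign_mul_self Φ.color σ v
      rw [herase v hv, hsign]
      simp only [hd, true_and]
    · intro v hv
      constructor
      · intro hvτ hc
        obtain ⟨w, hw, hwv⟩ := Finset.mem_image.1 hc
        have := color_injOn hf (Finset.mem_union_right _ hw) hv hwv
        exact Finset.disjoint_left.1 hdisj hvτ (this ▸ hw)
      · intro hc
        exact (Finset.mem_union.1 hv).resolve_right
          fun h => hc (Finset.mem_image_of_mem _ h)
  · rw [if_neg (fun h => hf h.2), map_zero]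
    refine Finset.sum_eq_zero fun v hv => if_neg fun h => hf ?_
    exact mem_faces_of_subset h.2 hout
      (Finset.union_subset_union_left (Finset.erase_subset _ _))

theorem boundary_mem_supported_link {σ : Finset V} {x : Finset V →₀ ℂ}
    (hx : x ∈ Finsupp.supported ℂ ℂ {τ : Finset V | τ ∈ link Φ.outer σ}) :
    boundary ℂ Φ.color x ∈ Finsupp.supported ℂ ℂ {τ : Finset V | τ ∈ link Φ.outer σ} := by
  refine mem_of_linearMap_supported _ (fun τ hτ => ?_) hx
  obtain ⟨hdisj, hout⟩ := mem_link_outer.1 hτ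
  rw [boundary, Finsupp.linearCombination_single, one_smul]
  refine Submodule.sum_mem _ fun v _ => Finsupp.single_mem_supported ℂ _ (mem_link_outer.2 ?_)
  exact ⟨hdisj.mono_left (Finset.erase_subset _ _), mem_outer_of_subset hout
    (Finset.union_subset_union_left (Finset.erase_subset _ _))⟩

/-- On faces of `Φ` the composite is the projection onto those containing `σ`. Deleting a vertex
whose color is not in `σ` does not affect this containment. -/
theorem linkBoundary_joinMap_unjoinMap {X : Finset (Fin d)} {σ : Finset V} {n : ℕ}
    {z : Finset V →₀ ℂ} (hz : z ∈ Φ.chainsBetween X (σ.image Φ.color) n) :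
    Φ.linkBoundary (σ.image Φ.color) (Φ.joinMap σ (Φ.unjoinMap σ z))
      = Φ.joinMap σ (Φ.unjoinMap σ (Φ.linkBoundary (σ.image Φ.color) z)) := by
  refine eq_of_linearMap_supported
    (Φ.linkBoundary (σ.image Φ.color) ∘ₗ Φ.joinMap σ ∘ₗ Φ.unjoinMap σ)
    (Φ.joinMap σ ∘ₗ Φ.unjoinMap σ ∘ₗ Φ.linkBoundary (σ.image Φ.color)) (fun ρ hρ => ?_) hz
  have hf : ρ ∈ Φ.faces := hρ.1
  have hsingle := linkBoundary_single (D := σ.image Φ.color)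
    (τ := ρ.filter (fun v => Φ.color v ∉ σ.image Φ.color)) hf (Finset.filter_subset _ _)
    (fun v hv => by simp only [Finset.mem_filter, hv, true_and]) 1
  simp only [LinearMap.comp_apply]
  rw [joinMap_unjoinMap_single, hsingle, map_sum, map_sum, apply_ite (Φ.linkBoundary _),
    map_zero, hsingle]
  have hterm : ∀ v ∈ ρ.filter (fun v => Φ.color v ∉ σ.image Φ.color),
      (σ ⊆ ρ.erase v ↔ σ ⊆ ρ) := by
    intro v hv
    rw [Finset.subset_erase]
    refine and_iff_left fun h => (Finset.mem_filter.1 hv).2 (Finset.mem_image_of_mem _ h)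
  by_cases hσ : σ ⊆ ρ
  · rw [if_pos ⟨hσ, hf⟩]
    refine Finset.sum_congr rfl fun v hv => ?_
    split_ifs with h
    · rw [joinMap_unjoinMap_single, if_pos ⟨(hterm v hv).2 hσ, h⟩]
    · rw [map_zero, map_zero]
  · rw [if_neg fun h => hσ h.1]
    refine (Finset.sum_eq_zero fun v hv => ?_).symm
    split_ifs with h
    · rw [joinMap_unjoinMap_single, if_neg fun h' => hσ ((hterm v hv).1 h'.1)]
    · rw [map_zero, map_zero]

/-- A face whose colors include `D` contains exactly one subface with color set `D`, so the
projections decompose the chains into the contributions of the separate links. -/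
theorem sum_joinMap_unjoinMap {X D : Finset (Fin d)} {n : ℕ} {z : Finset V →₀ ℂ}
    (hz : z ∈ Φ.chainsBetween X D n) :
    ∑ σ ∈ Φ.outer.filter (fun σ => σ.image Φ.color = D), Φ.joinMap σ (Φ.unjoinMap σ z) = z := by
  have h := eq_of_linearMap_supported
    (∑ σ ∈ Φ.outer.filter (fun σ => σ.image Φ.color = D), Φ.joinMap σ ∘ₗ Φ.unjoinMap σ)
    LinearMap.id (fun ρ hρ => ?_) hz
  · simpa using h
  obtain ⟨hf, hD, -, -⟩ := hρ
  simp only [LinearMap.sum_apply, LinearMap.comp_apply, LinearMap.id_apply,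
    joinMap_unjoinMap_single]
  have himage : (ρ.filter (fun v => Φ.color v ∈ D)).image Φ.color = D := by
    ext c
    simp only [Finset.mem_image, Finset.mem_filter]
    constructor
    · rintro ⟨v, hv, rfl⟩
      exact hv.2
    · intro hc
      obtain ⟨v, hv, rfl⟩ := Finset.mem_image.1 (hD hc)
      exact ⟨v, ⟨hv, hc⟩, rfl⟩
  rw [Finset.sum_eq_single_of_mem (ρ.filter (fun v => Φ.color v ∈ D))]
  · rw [if_pos ⟨Finset.filter_subset _ _, hf⟩]
  · exact Finset.mem_filter.2 ⟨mem_outer.2 ⟨ρ, hf, Finset.filter_subset _ _⟩, himage⟩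
  · rintro σ hσ hne
    refine if_neg fun h => hne ?_
    have hσD := (Finset.mem_filter.1 hσ).2
    ext v
    rw [Finset.mem_filter]
    constructor
    · intro hv
      exact ⟨h.1 hv, hσD ▸ Finset.mem_image_of_mem _ hv⟩
    · rintro ⟨hv, hc⟩
      rw [← hσD] at hc
      obtain ⟨w, hw, hwv⟩ := Finset.mem_image.1 hc
      exact color_injOn hf (h.1 hw) hv hwv ▸ hw

theorem SatisfiesSerre.exists_linkBoundary_eq {l : ℕ} (hS : Φ.SatisfiesSerre l) {σ : Finset V}
    (hσ : σ ∈ Φ.outer) {n : ℕ} (hn : n < l) (hcard : σ.card + n < d) {z : Finset V →₀ ℂ}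
    (hz : z ∈ Φ.chainsBetween Finset.univ (σ.image Φ.color) n)
    (hz0 : Φ.linkBoundary (σ.image Φ.color) z = 0) :
    ∃ y ∈ Φ.chainsBetween Finset.univ (σ.image Φ.color) (n + 1),
      Φ.linkBoundary (σ.image Φ.color) y = Φ.joinMap σ (Φ.unjoinMap σ z) := by
  have hσc : (σ.image Φ.color).card = σ.card :=
    Finset.card_image_of_injOn (color_injOn_of_mem_outer hσ)
  have hdim := card_le_dim_link hσ
  -- The homology is in dimension `n - 1`. The bound `σ.card + n < d` and purity give `n ≤ dim`, and
  -- `n < l` gives `n ≤ l - 1`.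
  have hhom := hS σ hσ n (by omega)
  have hB : Φ.unjoinMap σ z ∈ chains ℂ (link Φ.outer σ) n := by
    refine mem_of_linearMap_supported _ (fun ρ hρ => ?_) hz
    obtain ⟨hf, -, -, hc⟩ := hρ
    rw [unjoinMap_single]
    split_ifs with h
    · refine Finsupp.single_mem_supported ℂ _ ⟨mem_link_outer.2 ⟨Finset.sdiff_disjoint, ?_⟩, ?_⟩
      · rw [Finset.sdiff_union_of_subset h]
        exact mem_outer_of_mem hf
      · rw [Finset.card_sdiff_of_subset h]
        omega
    · exact zero_mem _
  have hB' := Finsupp.supported_mono (R := ℂ) (M := ℂ)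
    (t := {τ : Finset V | τ ∈ link Φ.outer σ}) (fun τ hτ => hτ.1) hB
  have hcycle : Φ.unjoinMap σ z ∈
      relCycles ℂ Φ.color (link Φ.outer σ) (link Φ.inner σ) n := by
    refine ⟨hB, ?_⟩
    have hzero : Φ.joinMap σ (boundary ℂ Φ.color (Φ.unjoinMap σ z)) = 0 := by
      rw [joinMap_boundary hB', linkBoundary_joinMap_unjoinMap hz, hz0, map_zero, map_zero]
    have := sub_unjoinMap_joinMap_mem (boundary_mem_supported_link hB')
    rwa [hzero, map_zero, sub_zero] at this
  have hbound : Φ.unjoinMap σ z ∈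
      relBoundaries ℂ Φ.color (link Φ.outer σ) (link Φ.inner σ) n := by
    rw [RelHomology, Subquotient, Submodule.Quotient.subsingleton_iff,
      Submodule.submoduleOf_eq_top] at hhom
    exact hhom hcycle
  obtain ⟨_, ⟨y, hy, rfl⟩, γ, hγ, hsum⟩ := Submodule.mem_sup.1 hbound
  have hγ0 : Φ.joinMap σ γ = 0 := by
    rw [← Submodule.mem_bot ℂ]
    refine mem_of_linearMap_supported _ (fun τ hτ => ?_) hγ
    rw [joinMap_single, if_neg (fun h => (mem_link_inner.1 hτ.1).2 h.2)]
    exact zero_mem _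
  refine ⟨Φ.joinMap σ y, ?_, ?_⟩
  · refine mem_of_linearMap_supported _ (fun τ hτ => ?_) hy
    rw [joinMap_single]
    split_ifs with h
    · refine Finsupp.single_mem_supported ℂ _ ⟨h.2,
        Finset.image_subset_image Finset.subset_union_right, Finset.subset_univ _, ?_⟩
      have := hτ.2
      rw [Finset.card_union_of_disjoint h.1]
      omega
    · exact zero_mem _
  · rw [← joinMap_boundary, ← hsum, map_add, hγ0, add_zero]
    exact Finsupp.supported_mono (fun τ hτ => hτ.1) hy

theorem SatisfiesSerre.linksExact_univ {l : ℕ} (hS : Φ.SatisfiesSerre l)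
    (D : Finset (Fin d)) : Φ.LinksExact l Finset.univ D := by
  intro n hn hcard z hz hz0
  rw [Finset.card_univ, Fintype.card_fin] at hcard
  have h : ∀ σ ∈ Φ.outer.filter (fun σ => σ.image Φ.color = D),
      ∃ y ∈ Φ.chainsBetween Finset.univ D (n + 1),
        Φ.linkBoundary D y = Φ.joinMap σ (Φ.unjoinMap σ z) := by
    intro σ hσ
    obtain ⟨hσo, rfl⟩ := Finset.mem_filter.1 hσ
    rw [Finset.card_image_of_injOn (color_injOn_of_mem_outer hσo)] at hcard
    exact hS.exists_linkBoundary_eq hσo hn hcard hz hz0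
  choose! y hy hyz using h
  refine ⟨∑ σ ∈ Φ.outer.filter (fun σ => σ.image Φ.color = D), y σ,
    Submodule.sum_mem _ hy, ?_⟩
  rw [map_sum, Finset.sum_congr rfl hyz, sum_joinMap_unjoinMap hz]

end SerreCondition

/-! ### Combinatorics of interval sums and binomial weights -/

section IntervalSum

variable {ι A : Type*} [DecidableEq ι]

/-- The sum of `h` over the sets between `S` and `S ∪ D`. -/
def intervalSum [AddCommMonoid A] (h : Finset ι → A) (S D : Finset ι) : A :=
  ∑ E ∈ D.powerset, h (S ∪ E)

/-- The alternating sum of `f` over the sets between `D` and `S ∪ D`. -/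
def alternatingSum [AddCommGroup A] [Module ℂ A] (f : Finset ι → A) (S D : Finset ι) : A :=
  ∑ T ∈ S.powerset, (-1 : ℂ) ^ (S \ T).card • f (T ∪ D)

theorem intervalSum_empty [AddCommMonoid A] (h : Finset ι → A) (S : Finset ι) :
    intervalSum h S ∅ = h S := by
  simp [intervalSum]

theorem intervalSum_insert [AddCommMonoid A] (h : Finset ι → A) (S : Finset ι) {D : Finset ι}
    {c : ι} (hc : c ∉ D) :
    intervalSum h S (insert c D) = intervalSum h S D + intervalSum h (insert c S) D := by
  rw [intervalSum, Finset.sum_powerset_insert hc]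
  simp only [intervalSum, Finset.union_insert, Finset.insert_union]

theorem alternatingSum_insert [AddCommGroup A] [Module ℂ A] (f : Finset ι → A) {S : Finset ι}
    (D : Finset ι) {c : ι} (hc : c ∉ S) :
    alternatingSum f (insert c S) D = alternatingSum f S (insert c D) - alternatingSum f S D := by
  rw [alternatingSum, Finset.sum_powerset_insert hc, alternatingSum, alternatingSum, add_comm,
    sub_eq_add_neg, ← Finset.sum_neg_distrib]
  congr 1
  · refine Finset.sum_congr rfl fun T _ => ?_
    rw [Finset.insert_sdiff_insert, Finset.sdiff_insert_of_notMem hc, Finset.insert_union,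
      Finset.union_insert]
  · refine Finset.sum_congr rfl fun T hT => ?_
    have hcT : c ∉ T := fun h => hc (Finset.mem_powerset.1 hT h)
    rw [Finset.insert_sdiff_of_notMem _ hcT, Finset.card_insert_of_notMem
      (fun h => hc (Finset.mem_sdiff.1 h).1), pow_succ, mul_neg_one, neg_smul]

/-- Both sides agree at `D = ∅` and satisfy the same recursion: the value at `(S, insert c D)` is
the sum of the values at `(S, D)` and `(insert c S, D)`. -/
theorem intervalSum_alternatingSum [AddCommGroup A] [Module ℂ A] (f : Finset ι → A)
    (D : Finset ι) : ∀ S : Finset ι, Disjoint S D →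
      intervalSum (fun T => alternatingSum f T ∅) S D = alternatingSum f S D := by
  induction D using Finset.induction_on with
  | empty => exact fun S _ => intervalSum_empty _ S
  | insert c D hc ih =>
    intro S hS
    rw [Finset.disjoint_insert_right] at hS
    rw [intervalSum_insert _ _ hc, ih S hS.2, ih (insert c S)
      (Finset.disjoint_insert_left.2 ⟨hc, hS.2⟩), alternatingSum_insert f D hS.1,
      add_sub_cancel]

/-- The coefficient `(k - l + i).choose i` if `l ≤ k`, and zero otherwise. -/
def shiftedChoose (l i k : ℕ) : ℕ :=
  if l ≤ k then (k - l + i).choose i else 0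

theorem shiftedChoose_succ_succ (l i k : ℕ) :
    shiftedChoose (l + 1) i (k + 1) = shiftedChoose l i k := by
  simp [shiftedChoose]

theorem shiftedChoose_self (i k : ℕ) : shiftedChoose i i k = k.choose i := by
  rw [shiftedChoose]
  split_ifs with h
  · rw [Nat.sub_add_cancel h]
  · exact (Nat.choose_eq_zero_of_lt (not_le.1 h)).symm

/-- Each color of `X` is moved into `S`, lowering `l`, or into `D`, merging two interval sums. The
invariant `S.card + l = L` ensures that the terms left when `X` is exhausted are zero or have
`S.card = L`, where `hpos` applies. -/
theorem isEffectiveCharacter_sum_shiftedChoose {G : Type*} [Group G] {L : ℕ}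
    (h : Finset ι → G → ℂ)
    (hpos : ∀ S D, Disjoint S D → S.card = L → IsEffectiveCharacter (intervalSum h S D))
    (X : Finset ι) : ∀ (l i : ℕ) (S D : Finset ι), i ≤ l → S.card + l = L → Disjoint S D →
      Disjoint X S → Disjoint X D →
      IsEffectiveCharacter
        (∑ T ∈ X.powerset, shiftedChoose l i T.card • intervalSum h (S ∪ T) D) := by
  induction X using Finset.induction_on with
  | empty =>
    intro l i S D hi hcard hSD _ _
    rw [Finset.powerset_empty, Finset.sum_singleton, Finset.card_empty, Finset.union_empty]
    -- Only `T = ∅` remains. Its weight is 1 if `l = 0` and the default value 0 if `l > 0`.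
    rcases l with _ | l
    · obtain rfl := Nat.le_zero.1 hi
      simpa [shiftedChoose] using hpos S D hSD hcard
    · simpa [shiftedChoose] using IsEffectiveCharacter.zero
  | insert c X hc ih =>
    intro l i S D hi hcard hSD hXS hXD
    rw [Finset.disjoint_insert_left] at hXS hXD
    have hSD' : Disjoint S (insert c D) := Finset.disjoint_insert_right.2 ⟨hXS.1, hSD⟩
    have hXD' : Disjoint X (insert c D) := Finset.disjoint_insert_right.2 ⟨hc, hXD.2⟩
    have hSD'' : Disjoint (insert c S) D := Finset.disjoint_insert_left.2 ⟨hXD.1, hSD⟩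
    have hXS' : Disjoint X (insert c S) := Finset.disjoint_insert_right.2 ⟨hc, hXS.2⟩
    have hcardS : (insert c S).card = S.card + 1 := Finset.card_insert_of_notMem hXS.1
    have hcardT : ∀ T ∈ X.powerset, (insert c T).card = T.card + 1 := fun T hT =>
      Finset.card_insert_of_notMem fun h' => hc (Finset.mem_powerset.1 hT h')
    have hunion : ∀ T, S ∪ insert c T = insert c S ∪ T := fun T => by
      rw [Finset.union_insert, Finset.insert_union]
    have hD : ∀ T, intervalSum h (S ∪ T) (insert c D)
        = intervalSum h (S ∪ T) D + intervalSum h (insert c S ∪ T) D := fun T => by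
      rw [intervalSum_insert _ _ hXD.1, Finset.insert_union]
    rw [Finset.sum_powerset_insert hc]
    rcases l with _ | l
    · obtain rfl := Nat.le_zero.1 hi
      -- All weights are 1, so the sets with and without `c` pair up into intervals over `insert c
      -- D`.
      convert ih 0 0 S (insert c D) le_rfl hcard hSD' hXS.2 hXD' using 1
      rw [← Finset.sum_add_distrib]
      refine Finset.sum_congr rfl fun T hT => ?_
      simp only [shiftedChoose_self, Nat.choose_zero_right, one_smul, hunion, hD]
    rcases Nat.lt_succ_iff_lt_or_eq.1 (Nat.lt_succ_of_le hi) with hlt | rfl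
    -- The weight depends on `k - l` only, so the sets containing `c` form the same kind of sum with
    -- `l` lowered by one; `i ≤ l` still holds there.
    · refine (ih (l + 1) i S D hi hcard hSD hXS.2 hXD.2).add ?_
      convert ih l i (insert c S) D (by omega) (by omega) hSD'' hXS' hXD.2 using 1
      refine Finset.sum_congr rfl fun T hT => ?_
      rw [hcardT T hT, shiftedChoose_succ_succ, hunion]
    -- For `i = l + 1` lowering `l` alone would break `i ≤ l`. The weight is now `T.card.choose i`,
    -- and Pascal's rule splits the weight of `insert c T`: one part merges with the weight of `T`
    -- into an interval over `insert c D`, the other has both indices lowered.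
    · convert (ih (l + 1) (l + 1) S (insert c D) le_rfl hcard hSD' hXS.2 hXD').add
        (ih l l (insert c S) D le_rfl (by omega) hSD'' hXS' hXD.2) using 1
      rw [← Finset.sum_add_distrib, ← Finset.sum_add_distrib]
      refine Finset.sum_congr rfl fun T hT => ?_
      simp only [shiftedChoose_self]
      rw [hcardT T hT, hunion, hD, Nat.choose_succ_succ, add_smul, smul_add]
      abel

/-- Double counting: a `k`-set lies in `(Fintype.card ι - k).choose (j - k)` sets of size `j`. -/
theorem sum_powersetCard_sum_powerset [Fintype ι] [AddCommMonoid A] (h : Finset ι → A)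
    {l j : ℕ} (i : ℕ) :
    ∑ X ∈ Finset.powersetCard j Finset.univ, ∑ T ∈ X.powerset, shiftedChoose l i T.card • h T
      = ∑ k ∈ Finset.Icc l j, ((Fintype.card ι - k).choose (j - k) * (k - l + i).choose i) •
          ∑ T ∈ Finset.powersetCard k Finset.univ, h T := by
  rw [Finset.sum_comm' (t' := (Finset.univ : Finset (Finset ι)))
    (s' := fun T => (Finset.powersetCard j Finset.univ).filter (T ⊆ ·)) (by simp)]
  have hzero : ∀ T ∈ (Finset.univ : Finset (Finset ι)),
      T ∉ Finset.univ.filter (fun T : Finset ι => T.card ∈ Finset.Icc l j) →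
      ∑ X ∈ (Finset.powersetCard j Finset.univ).filter (T ⊆ ·),
        shiftedChoose l i T.card • h T = 0 := by
    intro T _ hT
    simp only [Finset.mem_filter, Finset.mem_univ, true_and, Finset.mem_Icc, not_and] at hT
    by_cases hl : l ≤ T.card
    · refine Finset.sum_eq_zero fun X hX => absurd ?_ (hT hl)
      obtain ⟨hX, hTX⟩ := Finset.mem_filter.1 hX
      exact (Finset.card_le_card hTX).trans_eq (Finset.mem_powersetCard.1 hX).2
    · simp [shiftedChoose, hl]
  rw [← Finset.sum_subset (Finset.subset_univ _) hzero,
    ← Finset.sum_fiberwise_of_maps_to (g := Finset.card) (t := Finset.Icc l j)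
      (fun T hT => (Finset.mem_filter.1 hT).2)]
  refine Finset.sum_congr rfl fun k hk => ?_
  have hfib : (Finset.univ.filter (fun T : Finset ι => T.card ∈ Finset.Icc l j)).filter
      (fun T => T.card = k) = Finset.powersetCard k Finset.univ := by
    ext T
    simp only [Finset.mem_filter, Finset.mem_univ, true_and, Finset.mem_powersetCard,
      Finset.subset_univ]
    exact ⟨fun hT => hT.2, fun hT => ⟨hT ▸ hk, hT⟩⟩
  rw [hfib, Finset.smul_sum]
  refine Finset.sum_congr rfl fun T hT => ?_
  obtain ⟨-, rfl⟩ := Finset.mem_powersetCard.1 hT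
  obtain ⟨hl, hj⟩ := Finset.mem_Icc.1 hk
  rw [Finset.sum_const, Finset.card_filter_powersetCard_subset _ _ _ (Finset.subset_univ _) hj,
    Finset.card_univ, smul_smul, shiftedChoose, if_pos hl]

end IntervalSum

/-! ### Effectiveness of the equivariant flag and h-vectors -/

section FlagVectors

variable {V : Type*} [DecidableEq V] {d : ℕ} {Φ : BalancedRelComplex V d}
  {G : Type*} [Group G] [MulAction G V]

theorem intervalSum_flagH {S D : Finset (Fin d)} (hSD : Disjoint S D) :
    intervalSum (Φ.flagH G) S D = alternatingSum (Φ.flagF G) S D := by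
  rw [← intervalSum_alternatingSum _ _ _ hSD]
  congr 1
  funext T
  simp [flagH, alternatingSum]

/-- Induction on `S` with `D` free: with `S` empty this is the permutation character on faces of
color set `D`, and the exact sequence given by `map_topCycles` matches the recursion
`alternatingSum_insert`. -/
theorem IsActedOnBy.hasCharacter_topCycles (hG : Φ.IsActedOnBy G) {l : ℕ}
    (h : ∀ X, ∀ D ⊆ X, Φ.LinksExact l X D) (S : Finset (Fin d)) :
    ∀ D, Disjoint S D → S.card ≤ l →
      HasCharacter (finsuppRep G (Finset V)) (Φ.topCycles S D)
        (alternatingSum (Φ.flagF G) S D) := by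
  induction S using Finset.induction_on with
  | empty =>
    intro D _ _
    have key := hasCharacter_supported (G := G)
      (Φ.faces.filter (fun σ => σ.image Φ.color = D)) (fun g σ hσ => by
        rw [Finset.mem_filter] at hσ ⊢
        rwa [hG.smul_mem_iff, hG.image_color_smul])
    have h₁ : Φ.topCycles ∅ D = Finsupp.supported ℂ ℂ
        (Φ.faces.filter (fun σ => σ.image Φ.color = D) : Set (Finset V)) := by
      simp [topCycles]
    have h₂ : alternatingSum (Φ.flagF G) ∅ D = Φ.flagF G D := by
      simp [alternatingSum]
    rw [h₁, h₂]
    simp only [Finset.filter_filter] at key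
    exact key
  | insert c S hc ih =>
    intro D hD hl
    rw [Finset.disjoint_insert_left] at hD
    rw [Finset.card_insert_of_notMem hc] at hl
    rw [topCycles_insert, alternatingSum_insert _ _ hc]
    exact (ih (insert c D) (Finset.disjoint_insert_right.2 ⟨hc, hD.2⟩) (by omega)).inf_ker
      (ih D hD.2 (by omega)) (Φ.colorBoundary c) (fun g => hG.colorBoundary_comp g c)
      (map_topCycles hD.2 hc hD.1 hl
        (h _ _ (Finset.subset_union_right.trans (Finset.subset_insert _ _))))

theorem SatisfiesSerre.isEffectiveCharacter_intervalSum {l : ℕ} (hS : Φ.SatisfiesSerre l)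
    (hG : Φ.IsActedOnBy G) {S D : Finset (Fin d)} (hSD : Disjoint S D) (hl : S.card ≤ l) :
    IsEffectiveCharacter (intervalSum (Φ.flagH G) S D) := by
  rw [intervalSum_flagH hSD]
  exact (hG.hasCharacter_topCycles (LinksExact.of_univ hS.linksExact_univ) S D hSD
    hl).isEffectiveCharacter

theorem SatisfiesSerre.isEffectiveCharacter_hVector {l : ℕ} (hS : Φ.SatisfiesSerre l)
    (hG : Φ.IsActedOnBy G) {i : ℕ} (hi : i ≤ l) : IsEffectiveCharacter (Φ.hVector G i) := by
  refine IsEffectiveCharacter.sum _ _ fun S hS' => ?_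
  rw [← intervalSum_empty (Φ.flagH G) S]
  exact hS.isEffectiveCharacter_intervalSum hG (Finset.disjoint_empty_right _)
    ((Finset.mem_powersetCard.1 hS').2.trans_le hi)

theorem SatisfiesSerre.isEffectiveCharacter_sum_hVector {l : ℕ} (hS : Φ.SatisfiesSerre l)
    (hG : Φ.IsActedOnBy G) {i : ℕ} (j : ℕ) (hi : i ≤ l) :
    IsEffectiveCharacter
      (∑ k ∈ Finset.Icc l j,
        (((d - k).choose (j - k) * (k - l + i).choose i : ℕ) : ℂ) • Φ.hVector G k) := by
  have h := sum_powersetCard_sum_powerset (Φ.flagH G) (l := l) (j := j) i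
  rw [Fintype.card_fin] at h
  simp only [Nat.cast_smul_eq_nsmul]
  change IsEffectiveCharacter (∑ k ∈ Finset.Icc l j,
    ((d - k).choose (j - k) * (k - l + i).choose i) •
      ∑ S ∈ Finset.powersetCard k Finset.univ, Φ.flagH G S)
  rw [← h]
  refine IsEffectiveCharacter.sum _ _ fun X _ => ?_
  have := isEffectiveCharacter_sum_shiftedChoose (Φ.flagH G)
    (fun S D hSD hcard => hS.isEffectiveCharacter_intervalSum hG hSD hcard.le) X l i ∅ ∅ hi
    (by simp) (Finset.disjoint_empty_right _) (Finset.disjoint_empty_right _)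
    (Finset.disjoint_empty_right _)
  simpa only [Finset.empty_union, intervalSum_empty] using this

end FlagVectors

end BalancedRelComplex

end

theorem mainTheorem5 {V : Type*} [DecidableEq V] {d : ℕ} (Φ : BalancedRelComplex V d)
    {G : Type*} [Group G] [Finite G] [MulAction G V] (hG : Φ.IsActedOnBy G)
    (l : ℕ) (hS : Φ.SatisfiesSerre l) :
    (∀ i : ℕ, i ≤ l → IsEffectiveCharacter (Φ.hVector G i)) ∧
    (∀ i j : ℕ, i ≤ l → l ≤ j → j ≤ d →
      IsEffectiveCharacter
        (∑ k ∈ Finset.Icc l j,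
          (((d - k).choose (j - k) * (k - l + i).choose i : ℕ) : ℂ) • Φ.hVector G k)) := by
  exact ⟨fun _ hi => hS.isEffectiveCharacter_hVector hG hi,
    fun _ j hi _ _ => hS.isEffectiveCharacter_sum_hVector hG j hi⟩
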